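/- Let $\mathbb{K}=\mathbb{R}$ or $\mathbb{C}$, let $E$ be a Banach space over $\mathbb{K}$ and $n\in\mathbb{N}$. Let $\mathcal{P}({}^nE)$ be the space of continuous $n$-homogeneous polynomials $P:E\to\mathbb{K}$ with the norm $\|P\|=\sup\{|P(x)|:\|x\|\le 1\}$, let $\mathcal{P}_w({}^nE)$ be the subspace of those $P$ whose restriction to every bounded subset of $E$ is continuous for the weak topology, and let $\|P\|_{es}=\inf\{\|P-R\|:R\in\mathcal{P}_w({}^nE)\}$. For $P\in\mathcal{P}({}^nE)$ let $\overline{P}:E^{**}\to\mathbb{K}$ be its Aron–Berner extension. A closed subspace $J$ of a normed space $X$ is called an M-ideal in $X$ if $X^*=J^\perp\oplus_1 J^\sharp$ for some closed subspace $J^\sharp$ of $X^*$, where $J^\perp$ is the annihilator of $J$; that is, $X^*=J^\perp\oplus J^\sharp$ and $\|\varphi+\psi\|=\|\varphi\|+\|\psi\|$ for $\varphi\in J^\perp$, $\psi\in J^\sharp$. The following are equivalent: (i) $\mathcal{P}_w({}^nE)$ is an M-ideal in $\mathcal{P}({}^nE)$. (ii) For every $P\in\mathcal{P}({}^nE)$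 there exists a net $(P_\alpha)_\alpha\subset\mathcal{P}_w({}^nE)$ such that $\overline{P_\alpha}(z)\to\overline{P}(z)$ for all $z\in E^{**}$ and $$\limsup_\alpha\|Q+P-P_\alpha\|\le\max\{\|Q\|,\ \|Q\|_{es}+\|P\|\}\quad\text{for all }Q\in\mathcal{P}({}^nE).$$ (iii) For every $P\in\mathcal{P}({}^nE)$ there exists a net $(P_\alpha)_\alpha\subset\mathcal{P}_w({}^nE)$ such that $\overline{P_\alpha}(z)\to\overline{P}(z)$ for all $z\in E^{**}$ and $$\limsup_\alpha\|Q+P-P_\alpha\|\le\max\{\|Q\|,\|P\|\}\quad\text{for all }Q\in\mathcal{P}_w({}^nE).$$ -/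

import Mathlib

open Filter Topology

universe u v

noncomputable section

/-- A continuous `n`-homogeneous polynomial `P : E → 𝕜`: the restriction to the diagonal of a
continuous `n`-linear form. -/
structure HomogPoly (𝕜 : Type v) (E : Type u) [RCLike 𝕜] [NormedAddCommGroup E]
    [NormedSpace 𝕜 E] (n : ℕ) : Type (max u v) where
  toFun : E → 𝕜
  exists_form' : ∃ A : ContinuousMultilinearMap 𝕜 (fun _ : Fin n => E) 𝕜,
    ∀ x, toFun x = A (fun _ => x)

namespace HomogPoly

variable {𝕜 : Type v} {E : Type u} [RCLike 𝕜] [NormedAddCommGroup E] [NormedSpace 𝕜 E] {n : ℕ}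

instance : CoeFun (HomogPoly 𝕜 E n) (fun _ => E → 𝕜) := ⟨toFun⟩

theorem exists_form (P : HomogPoly 𝕜 E n) :
    ∃ A : ContinuousMultilinearMap 𝕜 (fun _ : Fin n => E) 𝕜, ∀ x, P x = A (fun _ => x) :=
  P.exists_form'

theorem toFun_injective : Function.Injective (toFun : HomogPoly 𝕜 E n → E → 𝕜) := by
  rintro ⟨f, hf⟩ ⟨g, hg⟩ h
  cases h
  rfl

@[ext] theorem ext {P Q : HomogPoly 𝕜 E n} (h : ∀ x, P x = Q x) : P = Q :=
  toFun_injective (funext h)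

/-! The pointwise vector space operations. -/

instance : Zero (HomogPoly 𝕜 E n) := ⟨⟨fun _ => 0, 0, fun _ => rfl⟩⟩

instance : Add (HomogPoly 𝕜 E n) := ⟨fun P Q => ⟨fun x => P x + Q x, by
  obtain ⟨A, hA⟩ := P.exists_form
  obtain ⟨B, hB⟩ := Q.exists_form
  exact ⟨A + B, fun x => by simp [hA, hB]⟩⟩⟩

instance : Neg (HomogPoly 𝕜 E n) := ⟨fun P => ⟨fun x => - P x, by
  obtain ⟨A, hA⟩ := P.exists_form
  exact ⟨-A, fun x => by simp [hA]⟩⟩⟩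

instance : Sub (HomogPoly 𝕜 E n) := ⟨fun P Q => ⟨fun x => P x - Q x, by
  obtain ⟨A, hA⟩ := P.exists_form
  obtain ⟨B, hB⟩ := Q.exists_form
  exact ⟨A - B, fun x => by simp [hA, hB]⟩⟩⟩

instance : SMul 𝕜 (HomogPoly 𝕜 E n) := ⟨fun c P => ⟨fun x => c * P x, by
  obtain ⟨A, hA⟩ := P.exists_form
  exact ⟨c • A, fun x => by simp [hA]⟩⟩⟩

instance : SMul ℕ (HomogPoly 𝕜 E n) := ⟨fun c P => ⟨fun x => c • P x, by
  obtain ⟨A, hA⟩ := P.exists_form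
  exact ⟨c • A, fun x => by simp [hA]⟩⟩⟩

instance : SMul ℤ (HomogPoly 𝕜 E n) := ⟨fun c P => ⟨fun x => c • P x, by
  obtain ⟨A, hA⟩ := P.exists_form
  exact ⟨(c : 𝕜) • A, fun x => by simp [hA]⟩⟩⟩

@[simp] theorem zero_apply (x : E) : (0 : HomogPoly 𝕜 E n) x = 0 := rfl

@[simp] theorem add_apply (P Q : HomogPoly 𝕜 E n) (x : E) : (P + Q) x = P x + Q x := rfl

@[simp] theorem neg_apply (P : HomogPoly 𝕜 E n) (x : E) : (-P) x = - P x := rfl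

@[simp] theorem sub_apply (P Q : HomogPoly 𝕜 E n) (x : E) : (P - Q) x = P x - Q x := rfl

@[simp] theorem smul_apply (c : 𝕜) (P : HomogPoly 𝕜 E n) (x : E) : (c • P) x = c * P x := rfl

instance : AddCommGroup (HomogPoly 𝕜 E n) :=
  toFun_injective.addCommGroup _ rfl (fun _ _ => rfl) (fun _ => rfl) (fun _ _ => rfl)
    (fun _ _ => rfl) (fun _ _ => rfl)

instance : Module 𝕜 (HomogPoly 𝕜 E n) :=
  toFun_injective.module 𝕜
    { toFun := toFun, map_zero' := rfl, map_add' := fun _ _ => rfl } (fun _ _ => rfl)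

/-- The norm `‖P‖ = sup {|P x| : ‖x‖ ≤ 1}`. -/
instance : Norm (HomogPoly 𝕜 E n) := ⟨fun P => ⨆ x : Metric.closedBall (0 : E) 1, ‖P x‖⟩

theorem norm_def (P : HomogPoly 𝕜 E n) : ‖P‖ = ⨆ x : Metric.closedBall (0 : E) 1, ‖P x‖ := rfl

theorem bddAbove_ball (P : HomogPoly 𝕜 E n) :
    BddAbove (Set.range fun x : Metric.closedBall (0 : E) 1 => ‖P x‖) := by
  obtain ⟨A, hA⟩ := P.exists_form
  refine ⟨‖A‖, ?_⟩
  rintro _ ⟨x, rfl⟩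
  have hx : ‖(x : E)‖ ≤ 1 := mem_closedBall_zero_iff.1 x.2
  have h := A.le_opNorm (fun _ => (x : E))
  simp only [Finset.prod_const, Finset.card_univ, Fintype.card_fin] at h
  simp only [hA]
  refine h.trans (mul_le_of_le_one_right (norm_nonneg _) (pow_le_one₀ (norm_nonneg _) hx))

theorem norm_apply_le (P : HomogPoly 𝕜 E n) {x : E} (hx : ‖x‖ ≤ 1) : ‖P x‖ ≤ ‖P‖ :=
  le_ciSup P.bddAbove_ball (⟨x, by simpa using hx⟩ : Metric.closedBall (0 : E) 1)

instance : Nonempty (Metric.closedBall (0 : E) 1) := ⟨⟨0, by simp⟩⟩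

theorem norm_le_of_forall (P : HomogPoly 𝕜 E n) {C : ℝ} (h : ∀ x : E, ‖x‖ ≤ 1 → ‖P x‖ ≤ C) :
    ‖P‖ ≤ C :=
  ciSup_le fun x => h x (mem_closedBall_zero_iff.1 x.2)

theorem apply_smul (P : HomogPoly 𝕜 E n) (c : 𝕜) (x : E) : P (c • x) = c ^ n * P x := by
  obtain ⟨A, hA⟩ := P.exists_form
  have h := A.map_smul_univ (fun _ => c) (fun _ => x)
  simp only [Finset.prod_const, Finset.card_univ, Fintype.card_fin, smul_eq_mul] at h
  rw [hA, hA, h]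

theorem normedSpaceCore : NormedSpace.Core 𝕜 (HomogPoly 𝕜 E n) where
  norm_nonneg P := (norm_nonneg _).trans (P.norm_apply_le (x := 0) (by simp))
  norm_smul c P := by
    simp only [norm_def, smul_apply, norm_mul]
    rw [Real.mul_iSup_of_nonneg (norm_nonneg c)]
  norm_triangle P Q := norm_le_of_forall _ fun x hx =>
    (norm_add_le (P x) (Q x)).trans (add_le_add (P.norm_apply_le hx) (Q.norm_apply_le hx))
  norm_eq_zero_iff P := by
    constructor
    · intro h
      ext x
      have h0 : ∀ y : E, ‖y‖ ≤ 1 → P y = 0 := fun y hy =>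
        norm_le_zero_iff.1 ((P.norm_apply_le hy).trans h.le)
      by_cases hx : x = 0
      · exact h0 x (by simp [hx])
      · have hx' : (‖x‖ : 𝕜) ≠ 0 := by simpa using hx
        have e : x = (‖x‖ : 𝕜) • ((‖x‖ : 𝕜)⁻¹ • x) := by rw [smul_inv_smul₀ hx']
        rw [e, apply_smul, h0 _ (by simp [norm_smul, hx]), mul_zero, zero_apply]
    · rintro rfl
      simp [norm_def]

instance : NormedAddCommGroup (HomogPoly 𝕜 E n) := NormedAddCommGroup.ofCore normedSpaceCore

instance : NormedSpace 𝕜 (HomogPoly 𝕜 E n) := NormedSpace.ofCore normedSpaceCore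

/-- Every homogeneous polynomial is induced by a symmetric continuous multilinear form. -/
theorem exists_symm_form (P : HomogPoly 𝕜 E n) :
    ∃ A : ContinuousMultilinearMap 𝕜 (fun _ : Fin n => E) 𝕜,
      (∀ (σ : Equiv.Perm (Fin n)) (m : Fin n → E), A (fun i => m (σ i)) = A m) ∧
      ∀ x, P x = A (fun _ => x) := by
  obtain ⟨A, hA⟩ := P.exists_form
  refine ⟨((n.factorial : 𝕜)⁻¹) • ∑ τ : Equiv.Perm (Fin n), A.domDomCongr τ, ?_, ?_⟩
  · intro σ m
    simp only [_root_.smul_apply, _root_.sum_apply,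
      ContinuousMultilinearMap.domDomCongr_apply]
    congr 1
    exact Fintype.sum_equiv (Equiv.mulLeft σ) _ _ (fun τ => rfl)
  · intro x
    have h : (n.factorial : 𝕜) ≠ 0 := by exact_mod_cast n.factorial_ne_zero
    simp [hA, Fintype.card_perm, h]

/-- The symmetric continuous `n`-linear form inducing `P` (it is unique, by polarization). -/
def symmForm (P : HomogPoly 𝕜 E n) : ContinuousMultilinearMap 𝕜 (fun _ : Fin n => E) 𝕜 :=
  P.exists_symm_form.choose

end HomogPoly

/-- The value at `(z₁, …, zₙ)`, with `zᵢ ∈ E**`, of the canonical (Arens / Aron–Berner) extension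
of a continuous `n`-linear form `A`, as a function of `A`. It is defined by recursion on `n`: for
fixed `x ∈ E` the form `A (x, ·)` is extended to `(z₂, …, zₙ)`, and `z₁` is applied to the element
`x ↦ (extension of A (x, ·)) (z₂, …, zₙ)` of `E*`. Equivalently, it is the iterated limit of
`A (x₁, …, xₙ)` as `xₙ → zₙ`, …, `x₁ → z₁` weak-star with `xᵢ ∈ E` (the innermost limit being
the one in `xₙ`). -/
def arensEval (𝕜 : Type v) (E : Type u) [RCLike 𝕜] [NormedAddCommGroup E] [NormedSpace 𝕜 E] :
    (n : ℕ) → (Fin n → StrongDual 𝕜 (StrongDual 𝕜 E)) →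
      (ContinuousMultilinearMap 𝕜 (fun _ : Fin n => E) 𝕜 →L[𝕜] 𝕜)
  | 0, _ => ContinuousMultilinearMap.apply 𝕜 (fun _ : Fin 0 => E) 𝕜 0
  | n + 1, z =>
      (z 0).comp
        ((ContinuousLinearMap.compL 𝕜 E (ContinuousMultilinearMap 𝕜 (fun _ : Fin n => E) 𝕜) 𝕜
            (arensEval 𝕜 E n (Fin.tail z))).comp
          (continuousMultilinearCurryLeftEquiv 𝕜 (fun _ : Fin (n + 1) => E)
            𝕜).toContinuousLinearEquiv.toContinuousLinearMap)

namespace HomogPoly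

variable {𝕜 : Type v} {E : Type u} [RCLike 𝕜] [NormedAddCommGroup E] [NormedSpace 𝕜 E] {n : ℕ}

/-- The Aron–Berner extension of `P` to the bidual `E**`: the canonical extension of the symmetric
form of `P`, restricted to the diagonal. -/
def aronBerner (P : HomogPoly 𝕜 E n) (z : StrongDual 𝕜 (StrongDual 𝕜 E)) : 𝕜 :=
  arensEval 𝕜 E n (fun _ => z) P.symmForm

/-- The polynomials that are weakly continuous on bounded sets: the restriction of `P` to each
bounded set is continuous for the weak topology. -/
def weaklyContinuous (𝕜 : Type v) (E : Type u) [RCLike 𝕜] [NormedAddCommGroup E]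
    [NormedSpace 𝕜 E] (n : ℕ) : Submodule 𝕜 (HomogPoly 𝕜 E n) where
  carrier := {P | ∀ B : Set E, Bornology.IsBounded B →
    ContinuousOn (fun y : WeakSpace 𝕜 E => P ((toWeakSpace 𝕜 E).symm y)) (toWeakSpace 𝕜 E '' B)}
  zero_mem' := fun _ _ => continuousOn_const
  add_mem' := fun hP hQ B hB => (hP B hB).add (hQ B hB)
  smul_mem' := fun _ _ hP B hB => continuousOn_const.mul (hP B hB)

/-- The essential norm: the distance to the polynomials weakly continuous on bounded sets. -/
def essNorm (P : HomogPoly 𝕜 E n) : ℝ :=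
  Metric.infDist P (weaklyContinuous 𝕜 E n : Set (HomogPoly 𝕜 E n))

end HomogPoly

/-- The annihilator `J^⊥` of a subspace `J` of `X` in the dual space `X*`. -/
def annihilatorDual {𝕜 : Type*} {X : Type*} [RCLike 𝕜] [NormedAddCommGroup X] [NormedSpace 𝕜 X]
    (J : Submodule 𝕜 X) : Submodule 𝕜 (StrongDual 𝕜 X) where
  carrier := {φ | ∀ y ∈ J, φ y = 0}
  zero_mem' := fun _ _ => rfl
  add_mem' := fun hφ hψ y hy => by simp [hφ y hy, hψ y hy]
  smul_mem' := fun c φ hφ y hy => by simp [hφ y hy]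

/-- `J` is an M-ideal in `X`: it is closed, and `X* = J^⊥ ⊕₁ K` for some closed subspace `K`. -/
def IsMIdeal {𝕜 : Type*} {X : Type*} [RCLike 𝕜] [NormedAddCommGroup X] [NormedSpace 𝕜 X]
    (J : Submodule 𝕜 X) : Prop :=
  IsClosed (J : Set X) ∧
    ∃ K : Submodule 𝕜 (StrongDual 𝕜 X), IsClosed (K : Set (StrongDual 𝕜 X)) ∧
      IsCompl (annihilatorDual J) K ∧
      ∀ φ ∈ annihilatorDual J, ∀ ψ ∈ K, ‖φ + ψ‖ = ‖φ‖ + ‖ψ‖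

end

/-! (i) ⇒ (ii): for any closed `J` with `X* = J^⊥ ⊕₁ K`, Hahn–Banach separation
(`exists_mem_approx_of_l1_decomposition`) gives, for each `x`, some `y ∈ J` close to `x` on finitely
many functionals of `K` and with `‖q + x - y‖` almost at most `max ‖q‖ (d(q, J) + ‖x‖)` for finitely
many `q`. It remains to see that every evaluation `P ↦ P̄(z)` lies in `K`. Its norm is at most `‖z‖
^ n` by the Davie–Gamelin inequality (`norm_arensEval_le`), and the powers `f ^ n`, which lie in
`J`, already force its `K`-component to have norm at least `‖z‖ ^ n`. Norm additivity leaves nothing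
for the `J^⊥`-component.

(ii) ⇒ (iii): the essential norm vanishes on `J`.

(iii) ⇒ (i): take for `K` the functionals with the same norm as their restriction to `J`. The limsup
estimate makes every such functional tend to `0` along `P - P_α`. This gives uniqueness of
norm-preserving extensions, hence linearity of `K`, and then additivity of the norm
(`isMIdeal_of_forall_exists_filter`). -/

noncomputable section

/-! ### Norms through real parts, and Goldstine's theorem -/

section FunctionalAnalysis

variable {𝕜 X : Type*} [RCLike 𝕜] [NormedAddCommGroup X] [NormedSpace 𝕜 X]

/-- A unimodular scalar turns `F x` into `‖F x‖`, so real parts on a ball already see the norm. This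
links the real inequalities of Hahn–Banach separation with operator norms. -/
theorem opNorm_mul_le_of_re_le (F : StrongDual 𝕜 X) {r u : ℝ} (hr : 0 ≤ r)
    (h : ∀ x, ‖x‖ ≤ r → RCLike.re (F x) ≤ u) : ‖F‖ * r ≤ u := by
  have hu : 0 ≤ u := by simpa using h 0 (by simpa using hr)
  rcases hr.eq_or_lt with rfl | hr
  · simpa using hu
  rw [← le_div_iff₀ hr]
  refine F.opNorm_le_bound (by positivity) fun x => ?_
  rcases eq_or_ne x 0 with rfl | hx
  · simp
  have hx' : 0 < ‖x‖ := norm_pos_iff.2 hx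
  obtain ⟨c, hc, hcx⟩ := RCLike.exists_norm_eq_mul_self (F x)
  have h1 := h ((c * ((r / ‖x‖ : ℝ) : 𝕜)) • x) (by
    rw [norm_smul, norm_mul, hc, RCLike.norm_ofReal, abs_of_pos (by positivity)]
    field_simp; exact le_rfl)
  have h2 : F ((c * ((r / ‖x‖ : ℝ) : 𝕜)) • x) = ((r / ‖x‖ * ‖F x‖ : ℝ) : 𝕜) := by
    rw [map_smul, smul_eq_mul, RCLike.ofReal_mul, hcx]; ring
  rw [h2, RCLike.ofReal_re] at h1
  rw [div_mul_eq_mul_div, le_div_iff₀ hr]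
  rw [div_mul_eq_mul_div, div_le_iff₀ hx'] at h1
  linarith

/-- Goldstine's theorem for finitely many functionals. -/
theorem exists_norm_le_approx_bidual {ι : Type*} [Finite ι] (f : ι → StrongDual 𝕜 X)
    (z : StrongDual 𝕜 (StrongDual 𝕜 X)) {ε : ℝ} (hε : 0 < ε) :
    ∃ x : X, ‖x‖ ≤ ‖z‖ ∧ ∀ i, ‖f i x - z (f i)‖ < ε := by
  classical
  have := Fintype.ofFinite ι
  let _ : NormedSpace ℝ X := NormedSpace.restrictScalars ℝ 𝕜 X
  let _ : IsScalarTower ℝ 𝕜 X := inferInstance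
  let T : X →L[𝕜] (ι → 𝕜) := ContinuousLinearMap.pi f
  let b : ι → 𝕜 := fun i => z (f i)
  -- A functional separating `b` from the image of the ball pulls back to a combination `F` of the
  -- `f i` with `re (z F) > ‖F‖ * ‖z‖`, which is impossible.
  have hb : b ∈ closure (T '' Metric.closedBall 0 ‖z‖) := by
    by_contra hb
    have hconv : Convex ℝ (closure (T '' Metric.closedBall 0 ‖z‖)) :=
      ((convex_closedBall (0 : X) ‖z‖).is_linear_image
        ⟨fun x y => map_add T x y, fun c x => (T.restrictScalars ℝ).map_smul c x⟩).closure
    obtain ⟨g, u, hg, hu⟩ := RCLike.geometric_hahn_banach_closed_point (𝕜 := 𝕜) hconv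
      isClosed_closure hb
    let F : StrongDual 𝕜 X := ∑ i, g (Pi.single i 1) • f i
    have hgv : ∀ v : ι → 𝕜, g v = ∑ i, g (Pi.single i 1) * v i := fun v => by
      conv_lhs => rw [pi_eq_sum_univ' v]
      simp [map_sum, mul_comm]
    have h1 : ‖F‖ * ‖z‖ ≤ u := by
      refine opNorm_mul_le_of_re_le F (norm_nonneg z) fun x hx => ?_
      have h2 := hg (T x) (subset_closure ⟨x, by simpa using hx, rfl⟩)
      have h3 : g (T x) = F x := by
        rw [hgv]; simp [F, T]
      rw [h3] at h2
      exact h2.le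
    have h4 : g b = z F := by
      rw [hgv]; simp [F, b, map_sum]
    rw [h4] at hu
    have h5 := (RCLike.re_le_norm (z F)).trans (z.le_opNorm F)
    linarith
  obtain ⟨_, ⟨x, hx, rfl⟩, hxb⟩ := Metric.mem_closure_iff.1 hb ε hε
  refine ⟨x, by simpa using hx, fun i => ?_⟩
  rw [dist_comm, dist_eq_norm, pi_norm_lt_iff hε] at hxb
  exact hxb i

end FunctionalAnalysis

/-! ### Canonical extensions of multilinear forms and the Davie–Gamelin inequality -/

section ArensExtension

variable {𝕜 : Type v} {E : Type u} [RCLike 𝕜] [NormedAddCommGroup E] [NormedSpace 𝕜 E] {n : ℕ}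

theorem arensEval_zero (z : Fin 0 → StrongDual 𝕜 (StrongDual 𝕜 E))
    (A : ContinuousMultilinearMap 𝕜 (fun _ : Fin 0 => E) 𝕜) (m : Fin 0 → E) :
    arensEval 𝕜 E 0 z A = A m := by
  rw [Subsingleton.elim m 0]; rfl

theorem arensEval_succ (z : Fin (n + 1) → StrongDual 𝕜 (StrongDual 𝕜 E))
    (A : ContinuousMultilinearMap 𝕜 (fun _ : Fin (n + 1) => E) 𝕜) :
    arensEval 𝕜 E (n + 1) z A =
      z 0 ((arensEval 𝕜 E n (Fin.tail z)).comp A.curryLeft) := rfl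

/-- Finitely many multilinear forms admit a common finite sequence in `E` on whose increasing
subfamilies they approximate their canonical extensions at `(z, …, z)`. -/
theorem exists_seq_approx_arensEval (z : StrongDual 𝕜 (StrongDual 𝕜 E)) {ε : ℝ} (hε : 0 < ε)
    (N : ℕ) (S : Set (Σ n : ℕ, ContinuousMultilinearMap 𝕜 (fun _ : Fin n => E) 𝕜))
    (hS : S.Finite) :
    ∃ x : Fin N → E, (∀ j, ‖x j‖ ≤ ‖z‖) ∧ ∀ n A, ⟨n, A⟩ ∈ S → ∀ i : Fin n → Fin N, StrictMono i →
      ‖A (fun k => x (i k)) - arensEval 𝕜 E n (fun _ => z) A‖ ≤ n * ε := by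
  induction N generalizing S with
  | zero =>
    refine ⟨fun _ => 0, fun j => j.elim0, fun n A _ i _ => ?_⟩
    cases n with
    | zero => rw [arensEval_zero _ A (fun k => 0)]; simp
    | succ n => exact (i 0).elim0
  | succ N ih =>
    -- `F` is the functional to which `z` is applied in the first slot; degree `0` imposes no
    -- condition, hence the value `0`.
    let F : (Σ n : ℕ, ContinuousMultilinearMap 𝕜 (fun _ : Fin n => E) 𝕜) → StrongDual 𝕜 E
      | ⟨0, _⟩ => 0
      | ⟨n + 1, A⟩ => (arensEval 𝕜 E n (fun _ => z)).comp A.curryLeft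
    have := hS.to_subtype
    obtain ⟨x₀, hx₀, hx₀'⟩ := exists_norm_le_approx_bidual (fun s : S => F s) z hε
    let G : (Σ n : ℕ, ContinuousMultilinearMap 𝕜 (fun _ : Fin n => E) 𝕜) →
        (Σ n : ℕ, ContinuousMultilinearMap 𝕜 (fun _ : Fin n => E) 𝕜)
      | ⟨0, A⟩ => ⟨0, A⟩
      | ⟨n + 1, A⟩ => ⟨n, A.curryLeft x₀⟩
    -- Increasing tuples that start with `x₀` are governed by the form `A (x₀, ·)` in `G '' S`, all
    -- others by `A` itself.
    obtain ⟨x, hx, hxS⟩ := ih (S ∪ G '' S) (hS.union (hS.image G))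
    refine ⟨Fin.cons x₀ x, fun j => Fin.cases hx₀ hx j, fun n A hA i hi => ?_⟩
    cases n with
    | zero => rw [arensEval_zero _ A (fun k => (Fin.cons x₀ x : Fin (N + 1) → E) (i k))]; simp
    | succ n =>
      rcases Fin.eq_zero_or_eq_succ (i 0) with h0 | ⟨j, h0⟩
      · have hpos : ∀ k : Fin n, i k.succ ≠ 0 := fun k => by
          have := hi (Fin.succ_pos k)
          exact (Fin.zero_le _ |>.trans_lt this).ne'
        have h1 := hxS n (A.curryLeft x₀) (Or.inr ⟨_, hA, rfl⟩)
          (fun k => (i k.succ).pred (hpos k)) (fun a b hab => by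
            simpa using hi (Fin.succ_lt_succ_iff.2 hab))
        have h2 := hx₀' ⟨_, hA⟩
        have h3 : (fun k => (Fin.cons x₀ x : Fin (N + 1) → E) (i k)) =
            Fin.cons x₀ (fun k => x ((i k.succ).pred (hpos k))) := by
          funext k
          refine Fin.cases ?_ (fun k => ?_) k
          · simp [h0]
          · simp only [Fin.cons_succ]
            conv_lhs => rw [← Fin.succ_pred (i k.succ) (hpos k), Fin.cons_succ]
        rw [h3]
        have h4 := norm_sub_le_norm_sub_add_norm_sub
          (A (Fin.cons x₀ (fun k => x ((i k.succ).pred (hpos k)))))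
          (arensEval 𝕜 E n (fun _ => z) (A.curryLeft x₀))
          (arensEval 𝕜 E (n + 1) (fun _ => z) A)
        refine h4.trans ?_
        push_cast
        rw [add_mul, one_mul]
        exact add_le_add h1 h2.le
      · have hpos : ∀ k, i k ≠ 0 := fun k => by
          have := hi.monotone (Fin.zero_le k)
          rw [h0] at this
          exact ((Fin.succ_pos j).trans_le this).ne'
        have h1 := hxS (n + 1) A (Or.inl hA) (fun k => (i k).pred (hpos k)) (fun a b hab => by
            simpa using hi hab)
        convert h1 using 5 with k
        conv_lhs => rw [← Fin.succ_pred (i k) (hpos k), Fin.cons_succ]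

theorem card_injective_fin (n N : ℕ) :
    (Finset.univ.filter fun f : Fin n → Fin N => Function.Injective f).card =
      N.descFactorial n := by
  rw [← Fintype.card_subtype, Fintype.card_congr (Equiv.subtypeInjectiveEquivEmbedding _ _)]
  simp

/-- For large `N` almost all `n`-tuples from `N` points have distinct entries, so the repeated ones
drop out of the averages below. -/
theorem tendsto_descFactorial_div_pow (n : ℕ) :
    Tendsto (fun N : ℕ => (N.descFactorial n : ℝ) / (N : ℝ) ^ n) atTop (𝓝 1) := by
  refine (Asymptotics.isEquivalent_iff_tendsto_one ?_).1 (isEquivalent_descFactorial n)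
  filter_upwards [eventually_gt_atTop 0] with N hN
  positivity

/-- The Davie–Gamelin inequality: the canonical extension of a symmetric form is bounded on the
diagonal by the same constant as the form itself. -/
theorem norm_arensEval_le (z : StrongDual 𝕜 (StrongDual 𝕜 E))
    (A : ContinuousMultilinearMap 𝕜 (fun _ : Fin n => E) 𝕜)
    (hA : ∀ (σ : Equiv.Perm (Fin n)) (m : Fin n → E), A (fun i => m (σ i)) = A m)
    {C : ℝ} (hC : ∀ x, ‖x‖ ≤ ‖z‖ → ‖A (fun _ => x)‖ ≤ C) :
    ‖arensEval 𝕜 E n (fun _ => z) A‖ ≤ C := by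
  set L := arensEval 𝕜 E n (fun _ => z) A with hL
  set M := ‖A‖ * ‖z‖ ^ n + ‖L‖ with hM
  -- Expand `A` on the diagonal at `∑ j, x j` over all `N ^ n` tuples. Injective ones contribute `L`
  -- up to `n * ε`; for the rest the crude bound `M` suffices.
  have key : ∀ ε : ℝ, 0 < ε → ∀ N : ℕ, 0 < N →
      ‖L‖ ≤ C + n * ε + M * (1 - (N.descFactorial n : ℝ) / (N : ℝ) ^ n) := by
    intro ε hε N hN
    have hN' : (0 : ℝ) < (N : ℝ) ^ n := by positivity
    have hN0 : (N : 𝕜) ≠ 0 := by exact_mod_cast hN.ne'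
    obtain ⟨x, hx, hxA⟩ := exists_seq_approx_arensEval z hε N {⟨n, A⟩} (Set.finite_singleton _)
    -- Approximation is known for increasing tuples; by symmetry of `A`, sorting reduces any
    -- injective tuple to this case.
    have hinj : ∀ f : Fin n → Fin N, Function.Injective f →
        ‖A (fun k => x (f k)) - L‖ ≤ n * ε := fun f hf => by
      have h1 := hxA n A rfl (f ∘ Tuple.sort f)
        ((Tuple.monotone_sort f).strictMono_of_injective (hf.comp (Tuple.sort f).injective))
      have h2 := hA (Tuple.sort f) (fun k => x (f k))
      simp only [Function.comp_apply] at h1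
      rwa [h2] at h1
    have hany : ∀ f : Fin n → Fin N, ‖A (fun k => x (f k)) - L‖ ≤ M := fun f => by
      refine (norm_sub_le _ _).trans (add_le_add ((A.le_opNorm _).trans ?_) le_rfl)
      refine mul_le_mul_of_nonneg_left ?_ (norm_nonneg _)
      refine (Finset.prod_le_prod (fun _ _ => norm_nonneg _) (fun k _ => hx (f k))).trans ?_
      simp
    have hsum : A (fun _ => ∑ j, x j) = ∑ f : Fin n → Fin N, A (fun k => x (f k)) :=
      A.map_sum (fun _ j => x j)
    -- The average of the `x j` has norm at most `‖z‖`, so `hC` applies to it; homogeneity supplies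
    -- `N ^ n`.
    have havg : ‖A (fun _ => ∑ j, x j)‖ ≤ (N : ℝ) ^ n * C := by
      have h1 := A.map_smul_univ (fun _ => (N : 𝕜)) (fun _ => (N : 𝕜)⁻¹ • ∑ j, x j)
      simp only [smul_inv_smul₀ hN0, Finset.prod_const, Finset.card_univ, Fintype.card_fin,
        smul_eq_mul] at h1
      rw [h1, norm_mul, norm_pow, RCLike.norm_natCast]
      refine mul_le_mul_of_nonneg_left (hC _ ?_) hN'.le
      rw [norm_smul, norm_inv, RCLike.norm_natCast, inv_mul_le_iff₀ (by positivity)]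
      refine (norm_sum_le _ _).trans ((Finset.sum_le_sum fun j _ => hx j).trans ?_)
      simp
    have hcard := card_injective_fin n N
    have hle : (N : ℝ) ^ n * ‖L‖ - (N : ℝ) ^ n * C ≤
        (N : ℝ) ^ n * (n * ε) + ((N : ℝ) ^ n - N.descFactorial n) * M := by
      have h1 : (N : 𝕜) ^ n * L = A (fun _ => ∑ j, x j) -
          ∑ f : Fin n → Fin N, (A (fun k => x (f k)) - L) := by
        rw [Finset.sum_sub_distrib, ← hsum]
        simp
      have h2 : (N : ℝ) ^ n * ‖L‖ ≤ (N : ℝ) ^ n * C +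
          ∑ f : Fin n → Fin N, ‖A (fun k => x (f k)) - L‖ := by
        have := congrArg norm h1
        rw [norm_mul, norm_pow, RCLike.norm_natCast] at this
        rw [this]
        exact (norm_sub_le _ _).trans (add_le_add havg (norm_sum_le _ _))
      have h3 : ∑ f : Fin n → Fin N, ‖A (fun k => x (f k)) - L‖ ≤
          ∑ f : Fin n → Fin N, (n * ε + (1 - if Function.Injective f then 1 else 0) * M) := by
        refine Finset.sum_le_sum fun f _ => ?_
        split_ifs with hf
        · simpa using hinj f hf
        · have : 0 ≤ n * ε := by positivity
          linarith [hany f]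
      have h4 : ∑ f : Fin n → Fin N,
          ((n : ℝ) * ε + (1 - if Function.Injective f then 1 else 0) * M) =
          (N : ℝ) ^ n * (n * ε) + ((N : ℝ) ^ n - N.descFactorial n) * M := by
        rw [Finset.sum_add_distrib, ← Finset.sum_mul, ← Finset.sum_mul, Finset.sum_sub_distrib,
          Finset.sum_boole, hcard]
        simp [mul_assoc]
      linarith
    have h5 : (N : ℝ) ^ n * (M * (1 - (N.descFactorial n : ℝ) / (N : ℝ) ^ n)) =
        ((N : ℝ) ^ n - N.descFactorial n) * M := by
      field_simp
    refine le_of_mul_le_mul_left ?_ hN'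
    rw [mul_add, mul_add, h5]
    linarith
  refine le_of_forall_pos_le_add fun ε hε => ?_
  have hlim : Tendsto (fun N : ℕ => C + n * (ε / (n + 1)) +
      M * (1 - (N.descFactorial n : ℝ) / (N : ℝ) ^ n)) atTop
      (𝓝 (C + n * (ε / (n + 1)) + M * (1 - 1))) :=
    tendsto_const_nhds.add (tendsto_const_nhds.mul
      (tendsto_const_nhds.sub (tendsto_descFactorial_div_pow n)))
  have h := ge_of_tendsto hlim ((eventually_gt_atTop 0).mono fun N hN =>
    key (ε / (n + 1)) (by positivity) N hN)
  have h' : n * (ε / (n + 1)) ≤ ε := by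
    rw [mul_div_assoc', div_le_iff₀ (by positivity)]
    nlinarith
  linarith

end ArensExtension

/-! ### The Aron–Berner extension as a functional, and the weakly continuous polynomials -/

namespace HomogPoly

variable {𝕜 : Type v} {E : Type u} [RCLike 𝕜] [NormedAddCommGroup E] [NormedSpace 𝕜 E] {n : ℕ}

theorem symmForm_symm (P : HomogPoly 𝕜 E n) (σ : Equiv.Perm (Fin n)) (m : Fin n → E) :
    P.symmForm (fun i => m (σ i)) = P.symmForm m :=
  P.exists_symm_form.choose_spec.1 σ m

theorem symmForm_diag (P : HomogPoly 𝕜 E n) (x : E) : P.symmForm (fun _ => x) = P x :=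
  (P.exists_symm_form.choose_spec.2 x).symm

theorem norm_apply_le_mul_pow (P : HomogPoly 𝕜 E n) (x : E) : ‖P x‖ ≤ ‖P‖ * ‖x‖ ^ n := by
  rcases eq_or_ne x 0 with rfl | hx
  · have h : P (0 : E) = (0 : 𝕜) ^ n * P (0 : E) := by
      rw [← P.apply_smul, smul_zero]
    rw [h, norm_mul, norm_pow, norm_zero, norm_zero, mul_comm]
    exact mul_le_mul_of_nonneg_right (P.norm_apply_le (by simp)) (by positivity)
  · have hx' : (‖x‖ : 𝕜) ≠ 0 := by simpa using hx
    have e : x = (‖x‖ : 𝕜) • ((‖x‖ : 𝕜)⁻¹ • x) := by rw [smul_inv_smul₀ hx']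
    conv_lhs => rw [e, P.apply_smul, norm_mul, norm_pow, RCLike.norm_ofReal, abs_norm, mul_comm]
    exact mul_le_mul_of_nonneg_right (P.norm_apply_le (by simp [norm_smul, hx])) (by positivity)

/-- The Aron–Berner extension may be computed from any symmetric form inducing `P`. -/
theorem arensEval_eq_aronBerner (P : HomogPoly 𝕜 E n)
    (A : ContinuousMultilinearMap 𝕜 (fun _ : Fin n => E) 𝕜)
    (hA : ∀ (σ : Equiv.Perm (Fin n)) (m : Fin n → E), A (fun i => m (σ i)) = A m)
    (hP : ∀ x, A (fun _ => x) = P x) (z : StrongDual 𝕜 (StrongDual 𝕜 E)) :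
    arensEval 𝕜 E n (fun _ => z) A = P.aronBerner z := by
  -- The difference of the two symmetric forms vanishes on the diagonal, so Davie–Gamelin with `C =
  -- 0` kills its extension.
  have h := norm_arensEval_le z (A - P.symmForm) (fun σ m => by
    simp [hA, symmForm_symm]) (C := 0) (fun x _ => by simp [hP, symmForm_diag])
  rw [map_sub] at h
  exact sub_eq_zero.1 (norm_le_zero_iff.1 h)

theorem aronBerner_add (P Q : HomogPoly 𝕜 E n) (z : StrongDual 𝕜 (StrongDual 𝕜 E)) :
    (P + Q).aronBerner z = P.aronBerner z + Q.aronBerner z := by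
  rw [← arensEval_eq_aronBerner (P + Q) (P.symmForm + Q.symmForm)
    (fun σ m => by simp [symmForm_symm]) (fun x => by simp [symmForm_diag]), map_add]
  rfl

theorem aronBerner_smul (c : 𝕜) (P : HomogPoly 𝕜 E n) (z : StrongDual 𝕜 (StrongDual 𝕜 E)) :
    (c • P).aronBerner z = c * P.aronBerner z := by
  rw [← arensEval_eq_aronBerner (c • P) (c • P.symmForm)
    (fun σ m => by simp [symmForm_symm]) (fun x => by simp [symmForm_diag]), map_smul]
  rfl

/-- The constant must be exactly `‖z‖ ^ n`: this matches the lower bound obtained from powers of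
functionals. -/
theorem norm_aronBerner_le (P : HomogPoly 𝕜 E n) (z : StrongDual 𝕜 (StrongDual 𝕜 E)) :
    ‖P.aronBerner z‖ ≤ ‖z‖ ^ n * ‖P‖ :=
  norm_arensEval_le z P.symmForm P.symmForm_symm fun x hx => by
    rw [symmForm_diag, mul_comm]
    exact (P.norm_apply_le_mul_pow x).trans (by gcongr)

/-- Evaluation of the Aron–Berner extension at a point of the bidual. -/
def aronBernerEval (n : ℕ) (z : StrongDual 𝕜 (StrongDual 𝕜 E)) : StrongDual 𝕜 (HomogPoly 𝕜 E n) :=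
  LinearMap.mkContinuous
    { toFun := fun P => P.aronBerner z
      map_add' := fun P Q => aronBerner_add P Q z
      map_smul' := fun c P => aronBerner_smul c P z } (‖z‖ ^ n) fun P => P.norm_aronBerner_le z

@[simp] theorem aronBernerEval_apply (z : StrongDual 𝕜 (StrongDual 𝕜 E)) (P : HomogPoly 𝕜 E n) :
    aronBernerEval n z P = P.aronBerner z := rfl

theorem norm_aronBernerEval_le (z : StrongDual 𝕜 (StrongDual 𝕜 E)) :
    ‖(aronBernerEval n z : StrongDual 𝕜 (HomogPoly 𝕜 E n))‖ ≤ ‖z‖ ^ n :=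
  LinearMap.mkContinuous_norm_le _ (by positivity) _

/-- The form `(x₁, …, xₙ) ↦ f x₁ ⋯ f xₙ`. -/
def dualPowForm (n : ℕ) (f : StrongDual 𝕜 E) :
    ContinuousMultilinearMap 𝕜 (fun _ : Fin n => E) 𝕜 :=
  (ContinuousMultilinearMap.mkPiAlgebra 𝕜 (Fin n) 𝕜).compContinuousLinearMap fun _ => f

@[simp] theorem dualPowForm_apply (f : StrongDual 𝕜 E) (m : Fin n → E) :
    dualPowForm n f m = ∏ i, f (m i) := by
  simp [dualPowForm]

/-- The polynomial `x ↦ (f x) ^ n`. -/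
def dualPow (n : ℕ) (f : StrongDual 𝕜 E) : HomogPoly 𝕜 E n :=
  ⟨fun x => f x ^ n, dualPowForm n f, fun x => by simp⟩

@[simp] theorem dualPow_apply (f : StrongDual 𝕜 E) (x : E) : dualPow n f x = f x ^ n := rfl

theorem norm_dualPow_le (f : StrongDual 𝕜 E) : ‖dualPow n f‖ ≤ ‖f‖ ^ n :=
  norm_le_of_forall _ fun x hx => by
    rw [dualPow_apply, norm_pow]
    gcongr
    simpa using (f.le_opNorm x).trans (mul_le_of_le_one_right (norm_nonneg _) hx)

theorem arensEval_dualPowForm (f : StrongDual 𝕜 E) (z : StrongDual 𝕜 (StrongDual 𝕜 E)) :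
    arensEval 𝕜 E n (fun _ => z) (dualPowForm n f) = z f ^ n := by
  induction n with
  | zero => rw [arensEval_zero _ _ 0]; simp
  | succ n ih =>
    rw [arensEval_succ]
    have h : (arensEval 𝕜 E n (Fin.tail fun _ => z)).comp (dualPowForm (n + 1) f).curryLeft =
        (z f ^ n) • f := by
      ext x
      have h1 : (dualPowForm (n + 1) f).curryLeft x = f x • dualPowForm n f := by
        ext m
        simp [Fin.prod_univ_succ]
      have h2 : Fin.tail (fun _ : Fin (n + 1) => z) = fun _ => z := rfl
      rw [ContinuousLinearMap.comp_apply, h1, map_smul, h2, ih]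
      simp [mul_comm]
    rw [h, map_smul, smul_eq_mul, pow_succ]

theorem aronBerner_dualPow (f : StrongDual 𝕜 E) (z : StrongDual 𝕜 (StrongDual 𝕜 E)) :
    (dualPow n f).aronBerner z = z f ^ n := by
  rw [← arensEval_eq_aronBerner (dualPow n f) (dualPowForm n f)
    (fun σ m => by simpa using Equiv.prod_comp σ fun i => f (m i)) (fun x => by simp),
    arensEval_dualPowForm]

/-- These powers are the elements of the ideal on which evaluations at bidual points are tested. -/
theorem dualPow_mem_weaklyContinuous (f : StrongDual 𝕜 E) :
    dualPow n f ∈ weaklyContinuous 𝕜 E n := by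
  intro B _
  refine Continuous.continuousOn ?_
  have h : Continuous fun y : WeakSpace 𝕜 E => f ((toWeakSpace 𝕜 E).symm y) :=
    WeakBilin.eval_continuous (topDualPairing 𝕜 E).flip f
  exact h.pow n

theorem isClosed_weaklyContinuous :
    IsClosed (weaklyContinuous 𝕜 E n : Set (HomogPoly 𝕜 E n)) := by
  refine isClosed_of_closure_subset fun P hP B hB => ?_
  obtain ⟨r, hr⟩ := hB.exists_norm_le
  refine continuousOn_of_uniform_approx_of_continuousOn fun U hU => ?_
  obtain ⟨ε, hε, hεU⟩ := Metric.mem_uniformity_dist.1 hU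
  obtain ⟨Q, hQ, hPQ⟩ := Metric.mem_closure_iff.1 hP (ε / (|r| ^ n + 1)) (by positivity)
  refine ⟨_, hQ B hB, ?_⟩
  rintro _ ⟨x, hx, rfl⟩
  apply hεU
  rw [dist_eq_norm] at hPQ
  rw [LinearEquiv.symm_apply_apply, dist_eq_norm, ← sub_apply]
  calc ‖(P - Q) x‖ ≤ ‖P - Q‖ * ‖x‖ ^ n := norm_apply_le_mul_pow _ _
    _ ≤ ‖P - Q‖ * (|r| ^ n + 1) := by
      have h : ‖x‖ ≤ |r| := (hr x hx).trans (le_abs_self r)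
      have h' : ‖x‖ ^ n ≤ |r| ^ n := by gcongr
      gcongr
      linarith
    _ < ε := by rwa [lt_div_iff₀ (by positivity)] at hPQ

end HomogPoly

/-! ### M-ideals in general normed spaces -/

section MIdeal

variable {𝕜 X : Type*} [RCLike 𝕜] [NormedAddCommGroup X] [NormedSpace 𝕜 X]

theorem exists_norm_le_one_lt_re (F : StrongDual 𝕜 X) {δ : ℝ} (hδ : 0 < δ) :
    ∃ x, ‖x‖ ≤ 1 ∧ ‖F‖ - δ < RCLike.re (F x) := by
  by_contra! h
  have := opNorm_mul_le_of_re_le F zero_le_one h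
  linarith

/-- Such a `g` factors through the quotient by `J`; this is the source of the essential norm in the
estimate. -/
theorem norm_le_mul_infDist_of_mem_annihilatorDual {J : Submodule 𝕜 X} {g : StrongDual 𝕜 X}
    (hg : g ∈ annihilatorDual J) (x : X) : ‖g x‖ ≤ ‖g‖ * Metric.infDist x (J : Set X) := by
  rcases (norm_nonneg g).eq_or_lt with h0 | h0
  · simpa [← h0] using g.le_opNorm x
  rw [← div_le_iff₀' h0, Metric.le_infDist ⟨0, J.zero_mem⟩]
  intro y hy
  rw [div_le_iff₀' h0, dist_eq_norm]
  have h := g.le_opNorm (x - y)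
  rwa [map_sub, hg y hy, sub_zero] at h

/-- A nonzero value on the subspace could be rotated and scaled beyond any bound. -/
theorem eq_zero_of_re_le {J : Submodule 𝕜 X} {F : StrongDual 𝕜 X} {c : ℝ}
    (h : ∀ y ∈ J, RCLike.re (F y) ≤ c) : F ∈ annihilatorDual J := by
  intro y hy
  by_contra hF
  have hF' : 0 < ‖F y‖ := norm_pos_iff.2 hF
  obtain ⟨a, _, ha⟩ := RCLike.exists_norm_eq_mul_self (F y)
  have h1 := h ((a * (((|c| + 1) / ‖F y‖ : ℝ) : 𝕜)) • y) (J.smul_mem _ hy)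
  have h2 : F ((a * (((|c| + 1) / ‖F y‖ : ℝ) : 𝕜)) • y) = ((|c| + 1 : ℝ) : 𝕜) := by
    rw [map_smul, smul_eq_mul, mul_right_comm, ← ha, ← RCLike.ofReal_mul, mul_div_cancel₀]
    exact hF'.ne'
  rw [h2, RCLike.ofReal_re] at h1
  linarith [le_abs_self c]

/-- If `X* = J^⊥ ⊕₁ K`, every `x` is simultaneously approximated by elements of `J` on finitely
many functionals in `K` and in the norm inequalities of the M-ideal decomposition. -/
theorem exists_mem_approx_of_l1_decomposition {J : Submodule 𝕜 X}
    {K : Submodule 𝕜 (StrongDual 𝕜 X)} (hJK : IsCompl (annihilatorDual J) K)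
    (hnorm : ∀ φ ∈ annihilatorDual J, ∀ ψ ∈ K, ‖φ + ψ‖ = ‖φ‖ + ‖ψ‖)
    (x : X) (S : Finset (StrongDual 𝕜 X)) (hS : ∀ φ ∈ S, φ ∈ K) (T : Finset X)
    {ε : ℝ} (hε : 0 < ε) :
    ∃ y ∈ J, (∀ φ ∈ S, ‖φ (x - y)‖ < ε) ∧
      ∀ q ∈ T, ‖q + x - y‖ < max ‖q‖ (Metric.infDist q (J : Set X) + ‖x‖) + ε := by
  classical
  let _ : NormedSpace ℝ X := NormedSpace.restrictScalars ℝ 𝕜 X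
  have _ : IsScalarTower ℝ 𝕜 X := inferInstance
  let r : X → ℝ := fun q => max ‖q‖ (Metric.infDist q (J : Set X) + ‖x‖)
  have hr : ∀ q, 0 ≤ r q := fun q => (norm_nonneg q).trans (le_max_left _ _)
  -- `base - L y` lists all `q + x - y` and all `φ (x - y)`. A suitable `y` exists exactly when `C`
  -- meets the open convex box `D`; otherwise the two can be separated.
  let D : Set ((T → X) × (S → 𝕜)) :=
    (Set.univ.pi fun q : T => Metric.ball 0 (r q + ε)) ×ˢ
      (Set.univ.pi fun _ : S => Metric.ball 0 ε)
  let base : (T → X) × (S → 𝕜) := (fun q => (q : X) + x, fun φ => (φ : StrongDual 𝕜 X) x)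
  let L : X →L[𝕜] (T → X) × (S → 𝕜) :=
    (ContinuousLinearMap.pi fun _ => ContinuousLinearMap.id 𝕜 X).prod
      (ContinuousLinearMap.pi fun φ : S => (φ : StrongDual 𝕜 X))
  let C : Set ((T → X) × (S → 𝕜)) := (fun y => base - L y) '' (J : Set X)
  by_cases hDC : Disjoint D C
  swap
  · obtain ⟨_, hD, y, hy, rfl⟩ := Set.not_disjoint_iff.1 hDC
    refine ⟨y, hy, fun φ hφ => ?_, fun q hq => ?_⟩
    · have := hD.2 ⟨φ, hφ⟩ trivial
      rw [mem_ball_zero_iff] at this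
      rw [map_sub]
      exact this
    · have := hD.1 ⟨q, hq⟩ trivial
      rw [mem_ball_zero_iff] at this
      exact this
  exfalso
  have hDo : IsOpen D := (isOpen_set_pi Set.finite_univ fun _ _ => Metric.isOpen_ball).prod
    (isOpen_set_pi Set.finite_univ fun _ _ => Metric.isOpen_ball)
  have hDc : Convex ℝ D := by
    refine Convex.prod (convex_pi fun q _ => ?_) (convex_pi fun φ _ => ?_)
    · exact convex_ball (0 : X) (r q + ε)
    · exact convex_ball (0 : 𝕜) ε
  have hCc : Convex ℝ C := by
    rintro _ ⟨y, hy, rfl⟩ _ ⟨w, hw, rfl⟩ a b _ _ hab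
    refine ⟨(a : 𝕜) • y + (b : 𝕜) • w, J.add_mem (J.smul_mem _ hy) (J.smul_mem _ hw), ?_⟩
    have h1 : ∀ c : ℝ, ∀ y : X, L ((c : 𝕜) • y) = c • L y := fun c y => by
      rw [map_smul]; exact RCLike.real_smul_eq_coe_smul (K := 𝕜) c (L y) |>.symm
    have hb : base = a • base + b • base := by rw [← add_smul, hab, one_smul]
    simp only [map_add, h1, smul_sub]
    conv_lhs => rw [hb]
    abel
  obtain ⟨f, u, hfD, hfC⟩ := RCLike.geometric_hahn_banach_open (𝕜 := 𝕜) hDc hDo hCc hDC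
  let fX : T → StrongDual 𝕜 X := fun q =>
    f.comp ((ContinuousLinearMap.inl 𝕜 (T → X) (S → 𝕜)).comp
      (ContinuousLinearMap.single 𝕜 (fun _ : T => X) q))
  let d : S → 𝕜 := fun φ => f (0, Pi.single φ 1)
  have hf : ∀ a c, f (a, c) = ∑ q, fX q (a q) + ∑ φ, c φ * d φ := fun a c => by
    have h1 : (a, c) = ((a, 0) : (T → X) × (S → 𝕜)) + (0, c) := by simp
    have h2 : ((a, 0) : (T → X) × (S → 𝕜)) = ∑ q, (Pi.single q (a q), 0) := by
      refine Prod.ext ?_ (by simp [Prod.snd_sum])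
      rw [Prod.fst_sum]
      exact (Finset.univ_sum_single a).symm
    have h3 : ((0, c) : (T → X) × (S → 𝕜)) = ∑ φ, c φ • (0, Pi.single φ 1) := by
      refine Prod.ext (by simp [Prod.fst_sum]) ?_
      rw [Prod.snd_sum]
      exact pi_eq_sum_univ' c
    rw [h1, map_add, h2, h3, map_sum, map_sum]
    simp only [map_smul, smul_eq_mul]
    rfl
  let F : StrongDual 𝕜 X := f.comp L
  have hF : F ∈ annihilatorDual J := by
    refine eq_zero_of_re_le (c := RCLike.re (f base) - u) fun y hy => ?_
    have h := hfC _ ⟨y, hy, rfl⟩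
    rw [map_sub, map_sub] at h
    change RCLike.re (f (L y)) ≤ _
    linarith
  have hdec : ∀ q, ∃ g ∈ annihilatorDual J, ∃ h ∈ K, g + h = fX q := fun q =>
    Submodule.mem_sup.1 (hJK.sup_eq_top ▸ Submodule.mem_top)
  choose g hg h hh hgh using hdec
  -- Comparing components of `F ∈ J^⊥`: this sum lies both in `K` and in `J^⊥`.
  have hsum : ∑ q, h q + ∑ φ : S, d φ • (φ : StrongDual 𝕜 X) = 0 := by
    have h1 : ∑ q, h q + ∑ φ : S, d φ • (φ : StrongDual 𝕜 X) = F - ∑ q, g q := by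
      ext w
      have h2 : F w = ∑ q, fX q w + ∑ φ : S, (φ : StrongDual 𝕜 X) w * d φ := hf _ _
      simp [h2, ← hgh, Finset.sum_add_distrib, mul_comm]
      ring
    have h3 : ∑ q, h q + ∑ φ : S, d φ • (φ : StrongDual 𝕜 X) ∈ K :=
      K.add_mem (K.sum_mem fun q _ => hh q)
        (K.sum_mem fun φ _ => K.smul_mem _ (hS φ φ.2))
    have h4 : F - ∑ q, g q ∈ annihilatorDual J :=
      Submodule.sub_mem _ hF (Submodule.sum_mem _ fun q _ => hg q)
    exact Submodule.disjoint_def.1 hJK.disjoint _ (h1 ▸ h4) h3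
  -- By `hsum` the terms `h q x` cancel those of the `φ x`, so `x` is seen only by the `g q`.
  have hbase : f base = ∑ q : T, (g q q + h q q + g q x) := by
    have h1 : f base = ∑ q : T, fX q (q + x) + ∑ φ : S, (φ : StrongDual 𝕜 X) x * d φ := hf _ _
    have h2 : ∑ q, h q x + ∑ φ : S, (φ : StrongDual 𝕜 X) x * d φ = 0 := by
      have := congrArg (fun ψ : StrongDual 𝕜 X => ψ x) hsum
      simpa [mul_comm] using this
    rw [h1, eq_neg_of_add_eq_zero_right h2, ← sub_eq_add_neg, ← Finset.sum_sub_distrib]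
    refine Finset.sum_congr rfl fun q _ => ?_
    rw [← hgh]
    simp only [map_add, _root_.add_apply]
    ring
  have hupper : RCLike.re (f base) ≤ ∑ q : T, ‖fX q‖ * r q := by
    refine (RCLike.re_le_norm _).trans ?_
    rw [hbase]
    refine (norm_sum_le _ _).trans (Finset.sum_le_sum fun q _ => ?_)
    have h1 := norm_le_mul_infDist_of_mem_annihilatorDual (hg q) (q : X)
    have h2 := (h q).le_opNorm (q : X)
    have h3 := (g q).le_opNorm x
    have h4 : ‖g q q + h q q + g q x‖ ≤ ‖g q q‖ + ‖h q q‖ + ‖g q x‖ := norm_add₃_le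
    have h5 : ‖h q‖ * ‖(q : X)‖ ≤ ‖h q‖ * r q :=
      mul_le_mul_of_nonneg_left (le_max_left _ _) (norm_nonneg _)
    have h6 : ‖g q‖ * (Metric.infDist (q : X) (J : Set X) + ‖x‖) ≤ ‖g q‖ * r q :=
      mul_le_mul_of_nonneg_left (le_max_right _ _) (norm_nonneg _)
    rw [← hgh, hnorm _ (hg q) _ (hh q)]
    linarith
  -- The slack `ε` in the radius lets `‖fX q‖ * r q` be reached inside the open ball. Then `f` at
  -- `(a, 0) ∈ D` is at least `f base` in real part, contrary to separation.
  have hlower : ∀ q : T, ∃ a : X, ‖a‖ < r q + ε ∧ ‖fX q‖ * r q ≤ RCLike.re (fX q a) := fun q => by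
    rcases (norm_nonneg (fX q)).eq_or_lt with h0 | h0
    · exact ⟨0, by simpa using add_pos_of_nonneg_of_pos (hr q) hε, by simp [← h0]⟩
    · by_contra! hlt
      have h1 := opNorm_mul_le_of_re_le (fX q) (r := r q + ε / 2)
        (add_nonneg (hr q) (by positivity)) fun a ha => (hlt a (by linarith)).le
      nlinarith
  choose a ha ha' using hlower
  have h1 := hfD (a, 0) ⟨fun q _ => by simpa using ha q, fun φ _ => by simpa using hε⟩
  have h2 := hfC base ⟨0, J.zero_mem, by simp⟩
  rw [hf] at h1
  simp only [Pi.zero_apply, zero_mul, Finset.sum_const_zero, add_zero, map_sum] at h1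
  have h3 := Finset.sum_le_sum fun q (_ : q ∈ Finset.univ) => ha' q
  linarith

/-- Choose `q` in the unit ball of `J` almost norming `h`. As `h (q + (x - y))` can hardly exceed
`‖h‖` in real part, `re h (x - y)` is almost nonpositive; `-q` bounds it from below, and `I • h`
handles the imaginary part. -/
theorem tendsto_apply_sub_of_eventually_norm_le {J : Submodule 𝕜 X} {x : X} {l : Filter X}
    (hl : ∀ q ∈ J, ‖q‖ ≤ 1 → ∀ ε > 0, ∀ᶠ y in l, ‖q + x - y‖ ≤ 1 + ε)
    {h : StrongDual 𝕜 X} (hh : ‖h‖ = ‖h.comp J.subtypeL‖) :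
    Tendsto (fun y => h (x - y)) l (𝓝 0) := by
  have hre : ∀ h : StrongDual 𝕜 X, ‖h‖ = ‖h.comp J.subtypeL‖ → ∀ ε > 0,
      ∀ᶠ y in l, |RCLike.re (h (x - y))| ≤ ε := by
    intro h hh ε hε
    set δ := ε / (‖h‖ + 1)
    have hδ : 0 < δ := by positivity
    have hδ' : δ * (‖h‖ + 1) = ε := div_mul_cancel₀ _ (by positivity)
    obtain ⟨q, hq, hqh⟩ := exists_norm_le_one_lt_re (h.comp J.subtypeL) hδ
    rw [← hh] at hqh
    replace hqh : ‖h‖ - δ < RCLike.re (h (q : X)) := hqh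
    filter_upwards [hl q q.2 hq δ hδ, hl (-q) (J.neg_mem q.2) (by simpa using hq) δ hδ]
      with y h1 h2
    have h3 := (RCLike.re_le_norm _).trans ((h.le_opNorm _).trans
      (mul_le_mul_of_nonneg_left h1 (norm_nonneg h)))
    have h4 := (neg_le_abs _).trans ((RCLike.abs_re_le_norm _).trans ((h.le_opNorm _).trans
      (mul_le_mul_of_nonneg_left h2 (norm_nonneg h))))
    rw [add_sub_assoc, map_add, map_add] at h3 h4
    rw [map_neg, map_neg] at h4
    rw [abs_le]
    constructor <;> nlinarith
  rw [Metric.tendsto_nhds]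
  intro ε hε
  have hI : ‖(RCLike.I : 𝕜) • h‖ = ‖((RCLike.I : 𝕜) • h).comp J.subtypeL‖ := by
    rw [ContinuousLinearMap.smul_comp, norm_smul, norm_smul, hh]
  filter_upwards [hre h hh (ε / 3) (by positivity), hre _ hI (ε / 3) (by positivity)] with y h1 h2
  rw [dist_zero_right]
  have h3 : RCLike.re (((RCLike.I : 𝕜) • h) (x - y)) = - RCLike.im (h (x - y)) := by
    simp only [_root_.smul_apply, smul_eq_mul, RCLike.I_mul_re]
  rw [h3, abs_neg] at h2
  have h4 := norm_add_le (RCLike.re (h (x - y)) : 𝕜) (RCLike.im (h (x - y)) * RCLike.I)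
  rw [RCLike.re_add_im, norm_mul, RCLike.norm_ofReal, RCLike.norm_ofReal] at h4
  have hI1 : ‖(RCLike.I : 𝕜)‖ ≤ 1 := by
    rw [RCLike.norm_I]
    split_ifs <;> norm_num
  have h5 := mul_le_mul_of_nonneg_left hI1
    (abs_nonneg (RCLike.im (h (x - y))))
  linarith

/-- A sufficient condition for M-ideals: each `x` in the unit ball has a filter of approximants in
`J` that works for all `q` in the unit ball of `J`. -/
theorem isMIdeal_of_forall_exists_filter {J : Submodule 𝕜 X} (hJ : IsClosed (J : Set X))
    (H : ∀ x : X, ‖x‖ ≤ 1 → ∃ l : Filter X, l.NeBot ∧ (∀ᶠ y in l, y ∈ J) ∧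
      ∀ q ∈ J, ‖q‖ ≤ 1 → ∀ ε > 0, ∀ᶠ y in l, ‖q + x - y‖ ≤ 1 + ε) :
    IsMIdeal J := by
  have hext : ∀ φ : StrongDual 𝕜 X, ∃ h : StrongDual 𝕜 X,
      ‖h‖ = ‖h.comp J.subtypeL‖ ∧ φ - h ∈ annihilatorDual J := fun φ => by
    obtain ⟨h, hh, hh'⟩ := exists_extension_norm_eq J (φ.comp J.subtypeL)
    refine ⟨h, ?_, fun y hy => ?_⟩
    · rw [hh']
      congr 1
      ext y
      exact (hh y).symm
    · have := hh ⟨y, hy⟩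
      simp only [ContinuousLinearMap.comp_apply, Submodule.subtypeL_apply] at this
      simp [this]
  let K : Submodule 𝕜 (StrongDual 𝕜 X) :=
    { carrier := {φ | ‖φ‖ = ‖φ.comp J.subtypeL‖}
      zero_mem' := by simp
      smul_mem' := fun c φ hφ => by
        rw [Set.mem_ofPred_eq] at hφ ⊢
        rw [ContinuousLinearMap.smul_comp, norm_smul, norm_smul, hφ]
      -- Let `h` be a norm-preserving extension of `φ + ψ` restricted to `J`. Then `φ + ψ - h` kills
      -- `J`, so its value at `x` equals that at `x - y`, which tends to `0`.
      add_mem' := fun {φ ψ} hφ hψ => by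
        obtain ⟨h, hh, hJh⟩ := hext (φ + ψ)
        have hzero : ∀ x, ‖x‖ ≤ 1 → (φ + ψ - h) x = 0 := fun x hx => by
          obtain ⟨l, hl, hlJ, hlq⟩ := H x hx
          have h1 := ((tendsto_apply_sub_of_eventually_norm_le hlq hφ).add
            (tendsto_apply_sub_of_eventually_norm_le hlq hψ)).sub
            (tendsto_apply_sub_of_eventually_norm_le hlq hh)
          rw [add_zero, sub_zero] at h1
          refine tendsto_nhds_unique (tendsto_const_nhds.congr' ?_) h1
          filter_upwards [hlJ] with y hy
          have h2 := hJh y hy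
          calc (φ + ψ - h) x = (φ + ψ - h) (x - y) := by rw [map_sub, h2, sub_zero]
            _ = _ := rfl
        have h3 : φ + ψ = h := by
          rw [← sub_eq_zero, ← norm_le_zero_iff]
          simpa using opNorm_mul_le_of_re_le (φ + ψ - h) zero_le_one (u := 0)
            fun x hx => by rw [hzero x hx, map_zero]
        rw [h3]
        exact hh }
  have hK : ∀ φ, φ ∈ K ↔ ‖φ‖ = ‖φ.comp J.subtypeL‖ := fun φ => Iff.rfl
  refine ⟨hJ, K, ?_, ⟨?_, ?_⟩, fun g hg h hh => ?_⟩
  · exact isClosed_eq continuous_norm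
      (((ContinuousLinearMap.compL 𝕜 J X 𝕜).flip J.subtypeL).continuous.norm)
  · rw [Submodule.disjoint_def]
    intro φ hφ hφK
    have h0 : φ.comp J.subtypeL = 0 := by
      ext y
      exact hφ y y.2
    rw [hK, h0, norm_zero] at hφK
    exact norm_eq_zero.1 hφK
  · rw [codisjoint_iff, Submodule.eq_top_iff']
    intro φ
    obtain ⟨h, hh, hφh⟩ := hext φ
    exact Submodule.mem_sup.2 ⟨φ - h, hφh, h, hh, sub_add_cancel _ _⟩
  -- Test `g + h` at `q + x - y`, where `x` almost norms `g` and `q ∈ J` almost norms `h`: `g` kills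
  -- `q` and `y`, and `h (x - y)` is small. The losses are `3 * δ` plus `δ * ‖g + h‖`.
  · refine le_antisymm (norm_add_le _ _) (le_of_forall_pos_le_add fun ε hε => ?_)
    set δ := ε / (3 + ‖g + h‖)
    have hδ : 0 < δ := by positivity
    have hδ' : δ * (3 + ‖g + h‖) = ε := div_mul_cancel₀ _ (by positivity)
    obtain ⟨x, hx, hxg⟩ := exists_norm_le_one_lt_re g hδ
    obtain ⟨q, hq, hqh⟩ := exists_norm_le_one_lt_re (h.comp J.subtypeL) hδ
    rw [← (hK h).1 hh] at hqh
    replace hqh : ‖h‖ - δ < RCLike.re (h (q : X)) := hqh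
    obtain ⟨l, hl, hlJ, hlq⟩ := H x hx
    have ht := Metric.tendsto_nhds.1 (tendsto_apply_sub_of_eventually_norm_le hlq hh) δ hδ
    obtain ⟨y, hyJ, hy, hyh⟩ := (hlJ.and ((hlq q q.2 hq δ hδ).and ht)).exists
    rw [dist_zero_right] at hyh
    have h1 := (neg_le_abs _).trans (RCLike.abs_re_le_norm (h (x - y)))
    have h2 := (RCLike.re_le_norm _).trans (((g + h).le_opNorm _).trans
      (mul_le_mul_of_nonneg_left hy (norm_nonneg (g + h))))
    have h3 : (g + h) (q + x - y) = g x + h q + h (x - y) := by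
      have h4 := hg q q.2
      have h5 := hg y hyJ
      simp only [_root_.add_apply, map_add, map_sub, h4, h5]
      ring
    rw [h3, map_add, map_add] at h2
    nlinarith

end MIdeal

/-! ### Bidual evaluations in the complement, and the approximating net -/

namespace HomogPoly

variable {𝕜 : Type v} {E : Type u} [RCLike 𝕜] [NormedAddCommGroup E] [NormedSpace 𝕜 E] {n : ℕ}

/-- Point evaluations of the Aron–Berner extension lie in every `ℓ₁`-complement of the annihilator
of the weakly continuous polynomials. -/
theorem aronBernerEval_mem_of_l1_decomposition {K : Submodule 𝕜 (StrongDual 𝕜 (HomogPoly 𝕜 E n))}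
    (hJK : IsCompl (annihilatorDual (weaklyContinuous 𝕜 E n)) K)
    (hnorm : ∀ φ ∈ annihilatorDual (weaklyContinuous 𝕜 E n), ∀ ψ ∈ K, ‖φ + ψ‖ = ‖φ‖ + ‖ψ‖)
    (z : StrongDual 𝕜 (StrongDual 𝕜 E)) : aronBernerEval n z ∈ K := by
  obtain ⟨φ, hφ, ψ, hψ, h⟩ := Submodule.mem_sup.1
    (hJK.sup_eq_top ▸ Submodule.mem_top : aronBernerEval n z ∈ _)
  have h1 : ‖φ‖ + ‖ψ‖ ≤ ‖z‖ ^ n := by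
    rw [← hnorm φ hφ ψ hψ, h]
    exact norm_aronBernerEval_le z
  have h2 : ∀ f : StrongDual 𝕜 E, ‖f‖ ≤ 1 → ‖z f‖ ^ n ≤ ‖ψ‖ := fun f hf => by
    have h3 : ψ (dualPow n f) = z f ^ n := by
      have h4 := congrArg (fun χ : StrongDual 𝕜 (HomogPoly 𝕜 E n) => χ (dualPow n f)) h
      simp only [_root_.add_apply, hφ _ (dualPow_mem_weaklyContinuous f), zero_add,
        aronBernerEval_apply, aronBerner_dualPow] at h4
      exact h4
    rw [← norm_pow, ← h3]
    refine (ψ.le_opNorm _).trans (mul_le_of_le_one_right (norm_nonneg _) ?_)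
    exact (norm_dualPow_le f).trans (pow_le_one₀ (norm_nonneg _) hf)
  have h3 : ‖z‖ ^ n ≤ ‖ψ‖ := by
    -- Truncation at `0` keeps the base nonnegative, so that taking powers is monotone.
    have hlim : Tendsto (fun δ : ℝ => (max (‖z‖ - δ) 0) ^ n) (𝓝[>] 0) (𝓝 (‖z‖ ^ n)) := by
      have hc : Continuous fun δ : ℝ => (max (‖z‖ - δ) 0) ^ n := by fun_prop
      have := hc.tendsto 0
      simp only [sub_zero, max_eq_left (norm_nonneg z)] at this
      exact this.mono_left nhdsWithin_le_nhds
    refine le_of_tendsto hlim ?_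
    filter_upwards [self_mem_nhdsWithin] with δ hδ
    obtain ⟨f, hf, hzf⟩ := exists_norm_le_one_lt_re z hδ
    refine le_trans ?_ (h2 f hf)
    have : max (‖z‖ - δ) 0 ≤ ‖z f‖ :=
      max_le (hzf.le.trans (RCLike.re_le_norm _)) (norm_nonneg _)
    gcongr
  have h4 : φ = 0 := norm_le_zero_iff.1 (by linarith)
  rw [← h, h4, zero_add]
  exact hψ

/-- The net is indexed by a finite set of bidual points, a finite set of polynomials `Q` and a
natural number `k` giving the tolerance `1 / (k + 1)`, under the product order. -/
theorem exists_net_of_isMIdeal (h : IsMIdeal (weaklyContinuous 𝕜 E n)) (P : HomogPoly 𝕜 E n) :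
    ∃ (ι : Type (max u v)) (_ : Preorder ι) (_ : IsDirectedOrder ι) (_ : Nonempty ι)
      (p : ι → HomogPoly 𝕜 E n),
      (∀ i, p i ∈ weaklyContinuous 𝕜 E n) ∧
      (∀ z : StrongDual 𝕜 (StrongDual 𝕜 E),
        Tendsto (fun i => (p i).aronBerner z) atTop (𝓝 (P.aronBerner z))) ∧
      ∀ Q : HomogPoly 𝕜 E n,
        limsup (fun i => ((‖Q + P - p i‖ : ℝ) : EReal)) atTop
          ≤ ((max ‖Q‖ (Q.essNorm + ‖P‖) : ℝ) : EReal) := by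
  classical
  obtain ⟨-, K, -, hJK, hnorm⟩ := h
  have hex : ∀ i : Finset (StrongDual 𝕜 (StrongDual 𝕜 E)) × Finset (HomogPoly 𝕜 E n) × ℕ,
      ∃ R ∈ weaklyContinuous 𝕜 E n,
        (∀ φ ∈ i.1.image (aronBernerEval n), ‖φ (P - R)‖ < 1 / ((i.2.2 : ℝ) + 1)) ∧
        ∀ Q ∈ i.2.1, ‖Q + P - R‖ < max ‖Q‖ (Q.essNorm + ‖P‖) + 1 / ((i.2.2 : ℝ) + 1) := fun i =>
    exists_mem_approx_of_l1_decomposition hJK hnorm P _ (fun φ hφ => by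
      obtain ⟨z, -, rfl⟩ := Finset.mem_image.1 hφ
      exact aronBernerEval_mem_of_l1_decomposition hJK hnorm z) _ (by positivity)
  choose p hp hpz hpQ using hex
  refine ⟨_, inferInstance, inferInstance, inferInstance, p, hp, fun z => ?_, fun Q => ?_⟩
  · rw [Metric.tendsto_atTop]
    intro ε hε
    obtain ⟨N, hN⟩ := exists_nat_one_div_lt hε
    refine ⟨({z}, ∅, N), fun i hi => ?_⟩
    have h1 := hpz i _ (Finset.mem_image_of_mem _ (hi.1 (Finset.mem_singleton_self z)))
    rw [map_sub, aronBernerEval_apply, aronBernerEval_apply, ← dist_eq_norm, dist_comm] at h1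
    have h2 : 1 / ((i.2.2 : ℝ) + 1) ≤ 1 / ((N : ℝ) + 1) :=
      Nat.one_div_le_one_div hi.2.2
    linarith
  · refine EReal.le_of_forall_lt_iff_le.1 fun r hr => ?_
    have hr' := sub_pos.2 (EReal.coe_lt_coe_iff.1 hr)
    obtain ⟨N, hN⟩ := exists_nat_one_div_lt hr'
    refine limsup_le_of_le (h := ?_)
    filter_upwards [eventually_ge_atTop (∅, {Q}, N)] with i hi
    have h1 := hpQ i Q (hi.2.1 (Finset.mem_singleton_self Q))
    have h2 : 1 / ((i.2.2 : ℝ) + 1) ≤ 1 / ((N : ℝ) + 1) :=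
      Nat.one_div_le_one_div hi.2.2
    exact EReal.coe_le_coe_iff.2 (by linarith)

theorem essNorm_eq_zero {Q : HomogPoly 𝕜 E n} (hQ : Q ∈ weaklyContinuous 𝕜 E n) :
    Q.essNorm = 0 :=
  Metric.infDist_zero_of_mem hQ

end HomogPoly

end

/-! ### The equivalence -/

theorem theorem3p2 {𝕜 : Type v} {E : Type u} [RCLike 𝕜] [NormedAddCommGroup E] [NormedSpace 𝕜 E]
    [CompleteSpace E] (n : ℕ) :
    List.TFAE [
      IsMIdeal (HomogPoly.weaklyContinuous 𝕜 E n),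
      ∀ P : HomogPoly 𝕜 E n,
        ∃ (ι : Type (max u v)) (_ : Preorder ι) (_ : IsDirectedOrder ι) (_ : Nonempty ι)
          (p : ι → HomogPoly 𝕜 E n),
          (∀ i, p i ∈ HomogPoly.weaklyContinuous 𝕜 E n) ∧
          (∀ z : StrongDual 𝕜 (StrongDual 𝕜 E),
            Tendsto (fun i => (p i).aronBerner z) atTop (𝓝 (P.aronBerner z))) ∧
          ∀ Q : HomogPoly 𝕜 E n,
            limsup (fun i => ((‖Q + P - p i‖ : ℝ) : EReal)) atTop
              ≤ ((max ‖Q‖ (Q.essNorm + ‖P‖) : ℝ) : EReal),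
      ∀ P : HomogPoly 𝕜 E n,
        ∃ (ι : Type (max u v)) (_ : Preorder ι) (_ : IsDirectedOrder ι) (_ : Nonempty ι)
          (p : ι → HomogPoly 𝕜 E n),
          (∀ i, p i ∈ HomogPoly.weaklyContinuous 𝕜 E n) ∧
          (∀ z : StrongDual 𝕜 (StrongDual 𝕜 E),
            Tendsto (fun i => (p i).aronBerner z) atTop (𝓝 (P.aronBerner z))) ∧
          ∀ Q ∈ HomogPoly.weaklyContinuous 𝕜 E n,
            limsup (fun i => ((‖Q + P - p i‖ : ℝ) : EReal)) atTop
              ≤ ((max ‖Q‖ ‖P‖ : ℝ) : EReal)] := by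
  tfae_have 1 → 2 := HomogPoly.exists_net_of_isMIdeal
  tfae_have 2 → 3 := fun h P => by
    obtain ⟨ι, h1, h2, h3, p, hp, hz, hQ⟩ := h P
    refine ⟨ι, h1, h2, h3, p, hp, hz, fun Q hQJ => ?_⟩
    simpa [HomogPoly.essNorm_eq_zero hQJ] using hQ Q
  tfae_have 3 → 1 := fun h => by
    refine isMIdeal_of_forall_exists_filter HomogPoly.isClosed_weaklyContinuous fun P hP => ?_
    obtain ⟨ι, _, _, _, p, hp, -, hQ⟩ := h P
    refine ⟨map p atTop, inferInstance, eventually_map.2 (Eventually.of_forall hp),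
      fun Q hQJ hQ1 ε hε => eventually_map.2 ?_⟩
    -- The strict gap between `max ‖Q‖ ‖P‖ ≤ 1` and `1 + ε` turns the limsup bound into an eventual
    -- one.
    have hlt : ((max ‖Q‖ ‖P‖ : ℝ) : EReal) < ((1 + ε : ℝ) : EReal) :=
      EReal.coe_lt_coe_iff.2 ((max_le hQ1 hP).trans_lt (by linarith))
    filter_upwards [eventually_lt_of_limsup_lt ((hQ Q hQJ).trans_lt hlt)] with i hi
    exact (EReal.coe_lt_coe_iff.1 hi).le
  tfae_finish
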